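/- Let $\mathcal S,\mathcal A$ be finite sets, $p(s'\mid s,a)$ a transition kernel, $\mu_0$ an initial distribution on $\mathcal S$, $\pi(a\mid s)$ a policy, $r:\mathcal S\times\mathcal A\to\mathbb R$ and $\gamma:\mathcal S\to[0,1]$. Let $S_0,A_0,R_1,S_1,A_1,R_2,\dots$ be states, actions and rewards generated by following $\pi$: $S_0\sim\mu_0$; given the past $S_0,A_0,R_1,\dots,R_t,S_t$, the action $A_t$ has distribution $\pi(\cdot\mid S_t)$; given this past and $A_t$, the state $S_{t+1}$ has distribution $p(\cdot\mid S_t,A_t)$; the rewards are uniformly bounded, and given the past, $A_t$ and $S_{t+1}$, the reward $R_{t+1}$ has conditional mean $r(S_t,A_t)$. Define the reverse return by $\bar G_0=0$ and $\bar G_{t}=R_{t}+\gamma(S_{t-1})\bar G_{t-1}$ for $t\ge 1$. Let $P_\pi(s,s')=\sum_a\pi(a\mid s)p(s'\mid s,a)$, $\Gamma=\mathrm{diag}(\gamma)$ and $\tilde P_\pi((s,a),s')=p(s'\mid s,a)$. Assume that the chain with transition matrix $P_\pi$ is ergodic (irreducible and aperiodic) and that $I-P_\pi^\top\Gamma$ is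 invertible. Then the chain has a unique stationary distribution $d_\pi$, and all its entries are positive. Put $D_\pi=\mathrm{diag}(d_\pi)$ and $\tilde D_\pi=\mathrm{diag}(\tilde d_\pi)$ with $\tilde d_\pi(s,a)=d_\pi(s)\pi(a\mid s)$. For every $s\in\mathcal S$ we have $\Pr(S_t=s)>0$ for all sufficiently large $t$, each $\bar G_t$ is integrable, and the limit $$\bar v_\pi(s)=\lim_{t\to\infty}\mathbb E[\bar G_t\mid S_t=s]$$ exists. The operator $$\bar{\mathcal T}y=D_\pi^{-1}\tilde P_\pi^\top\tilde D_\pi r+D_\pi^{-1}P_\pi^\top\Gamma D_\pi y\qquad(y\in\mathbb R^{\mathcal S})$$ is a contraction with respect to some weighted maximum norm $\|y\|_\infty^w=\max_s|y_s/w_s|$ with $w>0$ entrywise, $\bar v_\pi$ is its unique fixed point, and $$\bar v_\pi=D_\pi^{-1}(I-P_\pi^\top\Gamma)^{-1}\tilde P_\pi^\top\tilde D_\pi r.$$ -/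

import Mathlib

open MeasureTheory Filter Topology

/-- A finite MDP: transition kernel `p s a s' = p(s' | s, a)` and initial distribution `μ₀`. -/
structure FiniteMDP (𝒮 𝒜 : Type*) [Fintype 𝒮] [Fintype 𝒜] where
  p : 𝒮 → 𝒜 → 𝒮 → ℝ
  p_mem : ∀ s a, p s a ∈ stdSimplex ℝ 𝒮
  μ₀ : 𝒮 → ℝ
  μ₀_mem : μ₀ ∈ stdSimplex ℝ 𝒮

/-- A stochastic stationary policy, `prob s a = π(a | s)`. -/
structure Policy (𝒮 𝒜 : Type*) [Fintype 𝒮] [Fintype 𝒜] where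
  prob : 𝒮 → 𝒜 → ℝ
  prob_mem : ∀ s, prob s ∈ stdSimplex ℝ 𝒜

/-- A square matrix is aperiodic if for every state `s` the greatest common divisor of the return
times `{n ≥ 1 : (P ^ n) s s > 0}` is `1`. -/
def IsAperiodicMatrix {𝒮 : Type*} [Fintype 𝒮] [DecidableEq 𝒮] (P : Matrix 𝒮 𝒮 ℝ) : Prop :=
  ∀ s, Nat.setGcd {n : ℕ | 0 < n ∧ 0 < (P ^ n) s s} = 1

/-- Ergodicity of the finite chain with transition matrix `P`: irreducible and aperiodic. -/
def IsErgodicChain {𝒮 : Type*} [Fintype 𝒮] [DecidableEq 𝒮] (P : Matrix 𝒮 𝒮 ℝ) : Prop :=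
  P.IsIrreducible ∧ IsAperiodicMatrix P

/-- `d` is a stationary distribution of the chain with transition matrix `P`: `dᵀ P = dᵀ`. -/
def IsStationaryDistribution {𝒮 : Type*} [Fintype 𝒮] (P : Matrix 𝒮 𝒮 ℝ) (d : 𝒮 → ℝ) : Prop :=
  d ∈ stdSimplex ℝ 𝒮 ∧ Matrix.vecMul d P = d

/-- The weighted maximum norm `max_s |y s / w s|` (the norm of a finite product is the maximum). -/
noncomputable def weightedMaxNorm {𝒮 : Type*} [Fintype 𝒮] (w y : 𝒮 → ℝ) : ℝ :=
  ‖fun s => y s / w s‖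

namespace FiniteMDP

section Matrices

variable {𝒮 𝒜 : Type*} [Fintype 𝒮] [Fintype 𝒜]

/-- The state transition matrix `P_π(s, s') = ∑ₐ π(a | s) p(s' | s, a)`. -/
noncomputable def stateTransition (M : FiniteMDP 𝒮 𝒜) (π : Policy 𝒮 𝒜) : Matrix 𝒮 𝒮 ℝ :=
  Matrix.of fun s s' => ∑ a, π.prob s a * M.p s a s'

/-- The matrix `P̃((s, a), s') = p(s' | s, a)`. -/
def pairTransition (M : FiniteMDP 𝒮 𝒜) : Matrix (𝒮 × 𝒜) 𝒮 ℝ :=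
  Matrix.of fun x s' => M.p x.1 x.2 s'

/-- The matrix `D̃ = diag(d̃)` with `d̃(s, a) = d(s) π(a | s)`. -/
def pairWeight [DecidableEq 𝒮] [DecidableEq 𝒜] (π : Policy 𝒮 𝒜) (d : 𝒮 → ℝ) :
    Matrix (𝒮 × 𝒜) (𝒮 × 𝒜) ℝ :=
  Matrix.diagonal fun x => d x.1 * π.prob x.1 x.2

/-- The reverse Bellman operator `y ↦ D⁻¹ P̃ᵀ D̃ r + D⁻¹ Pᵀ Γ D y`, where `D = diag(d)` and
`Γ = diag(γ)`. -/
noncomputable def reverseBellman [DecidableEq 𝒮] [DecidableEq 𝒜] (M : FiniteMDP 𝒮 𝒜)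
    (π : Policy 𝒮 𝒜) (r : 𝒮 × 𝒜 → ℝ) (γ d : 𝒮 → ℝ) (y : 𝒮 → ℝ) : 𝒮 → ℝ :=
  Matrix.mulVec ((Matrix.diagonal d)⁻¹ * M.pairTransition.transpose * pairWeight π d) r +
    Matrix.mulVec ((Matrix.diagonal d)⁻¹ * (M.stateTransition π).transpose * Matrix.diagonal γ *
      Matrix.diagonal d) y

end Matrices

end FiniteMDP

section Trajectories

variable {Ω 𝒮 𝒜 : Type*}

/-- The information `σ(S₀, …, S_t, A₀, …, A_{t-1}, R₁, …, R_t)` available when `A_t` is chosen. -/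
abbrev history [MeasurableSpace 𝒮] [MeasurableSpace 𝒜] (S : ℕ → Ω → 𝒮) (A : ℕ → Ω → 𝒜)
    (R : ℕ → Ω → ℝ) (t : ℕ) : MeasurableSpace Ω :=
  (⨆ i ∈ Set.Iic t, MeasurableSpace.comap (S i) inferInstance) ⊔
    (⨆ i ∈ Set.Iio t, MeasurableSpace.comap (A i) inferInstance) ⊔
    (⨆ i ∈ Set.Iio t, MeasurableSpace.comap (R (i + 1)) inferInstance)

/-- `S_t, A_t, R_{t+1}` (`t ≥ 0`) are the states, actions and rewards of an agent that follows `π`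
in the MDP `M`: `S₀ ∼ μ₀`, given the past `A_t ∼ π(· | S_t)`, `S_{t+1} ∼ p(· | S_t, A_t)`, and the
rewards are uniformly bounded and have mean `r(S_t, A_t)` given the past, `A_t` and `S_{t+1}`.
(`R 0` plays no role.) -/
structure IsTrajectory [Fintype 𝒮] [Fintype 𝒜] [MeasurableSpace 𝒮] [MeasurableSpace 𝒜]
    [MeasurableSpace Ω] (M : FiniteMDP 𝒮 𝒜) (π : Policy 𝒮 𝒜) (r : 𝒮 × 𝒜 → ℝ)
    (μ : Measure Ω) (S : ℕ → Ω → 𝒮) (A : ℕ → Ω → 𝒜) (R : ℕ → Ω → ℝ) : Prop where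
  measurable_state : ∀ t, Measurable (S t)
  measurable_action : ∀ t, Measurable (A t)
  measurable_reward : ∀ t, Measurable (R (t + 1))
  bounded_reward : ∃ C : ℝ, ∀ t, ∀ᵐ ω ∂μ, |R (t + 1) ω| ≤ C
  initial_state : ∀ s, μ.real (S 0 ⁻¹' {s}) = M.μ₀ s
  action_law : ∀ t a,
    μ[(A t ⁻¹' {a}).indicator (fun _ => (1 : ℝ)) | history S A R t]
      =ᵐ[μ] fun ω => π.prob (S t ω) a
  state_law : ∀ t s,
    μ[(S (t + 1) ⁻¹' {s}).indicator (fun _ => (1 : ℝ)) |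
        history S A R t ⊔ MeasurableSpace.comap (A t) inferInstance]
      =ᵐ[μ] fun ω => M.p (S t ω) (A t ω) s
  reward_mean : ∀ t,
    μ[R (t + 1) | history S A R t ⊔ MeasurableSpace.comap (A t) inferInstance ⊔
        MeasurableSpace.comap (S (t + 1)) inferInstance]
      =ᵐ[μ] fun ω => r (S t ω, A t ω)

/-- The reverse return: `Ḡ₀ = 0`, `Ḡ_{t+1} = R_{t+1} + γ(S_t) Ḡ_t`. -/
def reverseReturn (γ : 𝒮 → ℝ) (S : ℕ → Ω → 𝒮) (R : ℕ → Ω → ℝ) : ℕ → Ω → ℝ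
  | 0 => fun _ => 0
  | t + 1 => fun ω => R (t + 1) ω + γ (S t ω) * reverseReturn γ S R t ω

end Trajectories

set_option linter.unusedSectionVars false

section NonnegativeMatrices

variable {n : Type*} [Fintype n] [DecidableEq n] {P : Matrix n n ℝ}

lemma Matrix.pow_add_apply_pos (hP : ∀ i j, 0 ≤ P i j) {a b : ℕ} {i j k : n}
    (h₁ : 0 < (P ^ a) i j) (h₂ : 0 < (P ^ b) j k) : 0 < (P ^ (a + b)) i k := by
  rw [pow_add, Matrix.mul_apply]
  exact Finset.sum_pos' (fun l _ => mul_nonneg (Matrix.pow_apply_nonneg hP a i l)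
    (Matrix.pow_apply_nonneg hP b l k)) ⟨j, Finset.mem_univ j, mul_pos h₁ h₂⟩

lemma IsAperiodicMatrix.eventually_pow_apply_self_pos (hP : ∀ i j, 0 ≤ P i j)
    (h : IsAperiodicMatrix P) (i : n) : ∀ᶠ k in atTop, 0 < (P ^ k) i i := by
  obtain ⟨N, hN⟩ := Nat.exists_mem_closure_of_ge {n : ℕ | 0 < n ∧ 0 < (P ^ n) i i}
  filter_upwards [eventually_ge_atTop N] with k hk
  let K : AddSubmonoid ℕ :=
    { carrier := {n | 0 < (P ^ n) i i}
      zero_mem' := by simp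
      add_mem' := Matrix.pow_add_apply_pos hP }
  have hle : AddSubmonoid.closure {n : ℕ | 0 < n ∧ 0 < (P ^ n) i i} ≤ K :=
    AddSubmonoid.closure_le.2 fun _ hx => hx.2
  exact hle (hN k hk (by rw [h i]; exact one_dvd k))

/-- All large powers of the transition matrix of an ergodic chain are entrywise positive. -/
lemma IsErgodicChain.eventually_pow_pos (h : IsErgodicChain P) :
    ∀ᶠ k in atTop, ∀ i j, 0 < (P ^ k) i j := by
  have hP := h.1.nonneg
  simp only [eventually_all]
  intro i j
  obtain ⟨a, -, ha⟩ := (Matrix.isIrreducible_iff_exists_pow_pos hP).1 h.1 i j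
  have := (h.2.eventually_pow_apply_self_pos hP i)
  filter_upwards [(tendsto_sub_atTop_nat a).eventually this, eventually_ge_atTop a] with k hk hak
  have := Matrix.pow_add_apply_pos hP hk ha
  rwa [Nat.sub_add_cancel hak] at this

lemma Matrix.sum_vecMul_of_mem_rowStochastic (hP : P ∈ Matrix.rowStochastic ℝ n) (x : n → ℝ) :
    ∑ j, Matrix.vecMul x P j = ∑ i, x i := by
  simp only [Matrix.vecMul, dotProduct]
  rw [Finset.sum_comm]
  simp [← Finset.mul_sum, Matrix.sum_row_of_mem_rowStochastic hP]

lemma Matrix.abs_vecMul_le_of_mem_rowStochastic (hP : P ∈ Matrix.rowStochastic ℝ n) (x : n → ℝ)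
    (j : n) : |Matrix.vecMul x P j| ≤ Matrix.vecMul (fun i => |x i|) P j := by
  simp only [Matrix.vecMul, dotProduct]
  refine (Finset.abs_sum_le_sum_abs _ _).trans (Finset.sum_le_sum fun i _ => ?_)
  rw [abs_mul, abs_of_nonneg (Matrix.nonneg_of_mem_rowStochastic hP)]

lemma Matrix.sum_abs_vecMul_le_of_mem_rowStochastic (hP : P ∈ Matrix.rowStochastic ℝ n)
    (x : n → ℝ) : ∑ j, |Matrix.vecMul x P j| ≤ ∑ i, |x i| :=
  (Finset.sum_le_sum fun j _ => Matrix.abs_vecMul_le_of_mem_rowStochastic hP x j).trans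
    (Matrix.sum_vecMul_of_mem_rowStochastic hP _).le

/-- Doeblin's contraction: an entrywise positive stochastic matrix strictly contracts the `ℓ¹` norm
on vectors with zero sum. -/
lemma Matrix.exists_sum_abs_vecMul_le_mul [Nonempty n] (hP : P ∈ Matrix.rowStochastic ℝ n)
    (hpos : ∀ i j, 0 < P i j) :
    ∃ κ : ℝ, 0 ≤ κ ∧ κ < 1 ∧ ∀ x : n → ℝ, ∑ i, x i = 0 →
      ∑ j, |Matrix.vecMul x P j| ≤ κ * ∑ i, |x i| := by
  obtain ⟨⟨i₀, j₀⟩, hmin⟩ := Finite.exists_min fun x : n × n => P x.1 x.2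
  set δ := P i₀ j₀
  have hδ : ∀ i j, δ ≤ P i j := fun i j => hmin (i, j)
  have hrow : ∀ i, ∑ j, (P i j - δ) = 1 - Fintype.card n * δ := fun i => by
    simp [Matrix.sum_row_of_mem_rowStochastic hP]
  refine ⟨1 - Fintype.card n * δ, ?_, ?_, fun x hx => ?_⟩
  · rw [← hrow i₀]
    exact Finset.sum_nonneg fun j _ => sub_nonneg.2 (hδ i₀ j)
  · have : (0 : ℝ) < Fintype.card n * δ :=
      mul_pos (Nat.cast_pos.2 Fintype.card_pos) (hpos i₀ j₀)
    linarith
  · calc ∑ j, |Matrix.vecMul x P j| = ∑ j, |∑ i, x i * (P i j - δ)| := by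
          refine Finset.sum_congr rfl fun j _ => ?_
          simp [Matrix.vecMul, dotProduct, mul_sub, ← Finset.sum_mul, hx]
      _ ≤ ∑ j, ∑ i, |x i| * (P i j - δ) := by
          refine Finset.sum_le_sum fun j _ => (Finset.abs_sum_le_sum_abs _ _).trans
            (Finset.sum_le_sum fun i _ => ?_)
          rw [abs_mul, abs_of_nonneg (sub_nonneg.2 (hδ i j))]
      _ = (1 - Fintype.card n * δ) * ∑ i, |x i| := by
          rw [Finset.sum_comm]
          simp_rw [← Finset.mul_sum, hrow]
          rw [← Finset.sum_mul, mul_comm]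

lemma Matrix.vecMul_pow_succ (x : n → ℝ) (P : Matrix n n ℝ) (k : ℕ) :
    Matrix.vecMul x (P ^ (k + 1)) = Matrix.vecMul (Matrix.vecMul x (P ^ k)) P := by
  rw [pow_succ, Matrix.vecMul_vecMul]

/-- An ergodic chain forgets its initial condition. -/
lemma IsErgodicChain.tendsto_vecMul_pow [Nonempty n] (h : IsErgodicChain P)
    (hP : P ∈ Matrix.rowStochastic ℝ n) (x : n → ℝ) (hx : ∑ i, x i = 0) :
    Tendsto (fun k => Matrix.vecMul x (P ^ k)) atTop (𝓝 0) := by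
  obtain ⟨N, hNpos, hN0⟩ := (h.eventually_pow_pos.and (eventually_gt_atTop 0)).exists
  obtain ⟨κ, hκ0, hκ1, hκ⟩ :=
    Matrix.exists_sum_abs_vecMul_le_mul (pow_mem hP N) hNpos
  have hblock : ∀ k, ∑ j, |Matrix.vecMul x (P ^ (N * k)) j| ≤ κ ^ k * ∑ i, |x i| := by
    intro k
    induction k with
    | zero => simp
    | succ k ih =>
      have h1 := hκ (Matrix.vecMul x (P ^ (N * k)))
        (by rw [Matrix.sum_vecMul_of_mem_rowStochastic (pow_mem hP _), hx])
      rw [Matrix.vecMul_vecMul, ← pow_add, ← Nat.mul_succ] at h1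
      refine h1.trans ?_
      rw [pow_succ', mul_assoc]
      exact mul_le_mul_of_nonneg_left ih hκ0
  have hbound : ∀ k, ∑ j, |Matrix.vecMul x (P ^ k) j| ≤ κ ^ (k / N) * ∑ i, |x i| := by
    intro k
    refine le_trans ?_ (hblock (k / N))
    conv_lhs => rw [← Nat.div_add_mod k N, pow_add, ← Matrix.vecMul_vecMul]
    exact Matrix.sum_abs_vecMul_le_of_mem_rowStochastic (pow_mem hP _) _
  have hlim : Tendsto (fun k : ℕ => κ ^ (k / N) * ∑ i, |x i|) atTop (𝓝 0) := by
    have := ((tendsto_pow_atTop_nhds_zero_of_lt_one hκ0 hκ1).comp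
      (Nat.tendsto_div_const_atTop hN0.ne')).mul_const (∑ i, |x i|)
    simpa using this
  rw [tendsto_pi_nhds]
  intro j
  refine squeeze_zero_norm (fun k => ?_) hlim
  exact (Finset.single_le_sum (f := fun j => |Matrix.vecMul x (P ^ k) j|)
    (fun _ _ => abs_nonneg _) (Finset.mem_univ j)).trans (hbound k)

lemma IsStationaryDistribution.vecMul_pow {d : n → ℝ} (hd : IsStationaryDistribution P d) (k : ℕ) :
    Matrix.vecMul d (P ^ k) = d := by
  induction k with
  | zero => simp
  | succ k ih => rw [Matrix.vecMul_pow_succ, ih, hd.2]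

lemma IsErgodicChain.tendsto_vecMul_pow_stationary [Nonempty n] (h : IsErgodicChain P)
    (hP : P ∈ Matrix.rowStochastic ℝ n) {d m : n → ℝ} (hd : IsStationaryDistribution P d)
    (hm : ∑ i, m i = 1) : Tendsto (fun k => Matrix.vecMul m (P ^ k)) atTop (𝓝 d) := by
  have := h.tendsto_vecMul_pow hP (m - d) (by simp [hm, hd.1.2])
  simp_rw [Matrix.sub_vecMul, hd.vecMul_pow] at this
  simpa using this.add_const d

lemma IsStationaryDistribution.unique [Nonempty n] (h : IsErgodicChain P)
    (hP : P ∈ Matrix.rowStochastic ℝ n) {d d' : n → ℝ} (hd : IsStationaryDistribution P d)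
    (hd' : IsStationaryDistribution P d') : d' = d := by
  have h1 := h.tendsto_vecMul_pow_stationary hP hd hd'.1.2
  have h2 := h.tendsto_vecMul_pow_stationary hP hd' hd'.1.2
  exact tendsto_nhds_unique h2 h1

lemma IsStationaryDistribution.pos (h : IsErgodicChain P) {d : n → ℝ}
    (hd : IsStationaryDistribution P d) (s : n) : 0 < d s := by
  obtain ⟨N, hN⟩ := h.eventually_pow_pos.exists
  obtain ⟨i, -, hi⟩ : ∃ i ∈ Finset.univ, 0 < d i := by
    refine Finset.exists_lt_of_sum_lt (f := fun _ => (0 : ℝ)) ?_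
    simp [hd.1.2]
  rw [← hd.vecMul_pow N]
  exact Finset.sum_pos' (fun l _ => mul_nonneg (hd.1.1 l) (hN l s).le)
    ⟨i, Finset.mem_univ i, mul_pos hi (hN i s)⟩

/-- A finite stochastic matrix has a stationary distribution. -/
lemma Matrix.exists_isStationaryDistribution [Nonempty n] (hP : P ∈ Matrix.rowStochastic ℝ n) :
    ∃ d, IsStationaryDistribution P d := by
  have hdet : (P - 1).det = 0 := Matrix.exists_mulVec_eq_zero_iff.1
    ⟨1, one_ne_zero, by simp [Matrix.sub_mulVec, Matrix.one_vecMul_of_mem_rowStochastic hP]⟩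
  obtain ⟨v, hv0, hv⟩ := Matrix.exists_vecMul_eq_zero_iff.2 hdet
  rw [Matrix.vecMul_sub, Matrix.vecMul_one, sub_eq_zero] at hv
  set u : n → ℝ := fun i => |v i|
  have hle : ∀ j ∈ Finset.univ, u j ≤ Matrix.vecMul u P j := fun j _ => by
    have := Matrix.abs_vecMul_le_of_mem_rowStochastic hP v j
    rwa [hv] at this
  have hu : Matrix.vecMul u P = u := by
    have := (Finset.sum_eq_sum_iff_of_le hle).1
      (Matrix.sum_vecMul_of_mem_rowStochastic hP u).symm
    ext j
    exact (this j (Finset.mem_univ j)).symm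
  have hpos : 0 < ∑ i, u i := by
    obtain ⟨i, hi⟩ := Function.ne_iff.1 hv0
    exact Finset.sum_pos' (fun i _ => abs_nonneg _) ⟨i, Finset.mem_univ i, abs_pos.2 hi⟩
  refine ⟨(∑ i, u i)⁻¹ • u, ⟨fun i => ?_, ?_⟩, ?_⟩
  · exact mul_nonneg (inv_nonneg.2 hpos.le) (abs_nonneg _)
  · simp only [Pi.smul_apply, smul_eq_mul, ← Finset.mul_sum]
    exact inv_mul_cancel₀ hpos.ne'
  · rw [Matrix.smul_vecMul, hu]

end NonnegativeMatrices

section WeightedMaxNorm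

variable {n : Type*} [Fintype n]

lemma weightedMaxNorm_nonneg (w y : n → ℝ) : 0 ≤ weightedMaxNorm w y := norm_nonneg _

lemma weightedMaxNorm_add_le (w y z : n → ℝ) :
    weightedMaxNorm w (y + z) ≤ weightedMaxNorm w y + weightedMaxNorm w z := by
  refine le_trans (le_of_eq ?_) (norm_add_le _ _)
  simp only [weightedMaxNorm]
  congr 1
  ext s
  simp [add_div]

lemma abs_le_mul_weightedMaxNorm {w : n → ℝ} (hw : ∀ s, 0 < w s) (y : n → ℝ) (s : n) :
    |y s| ≤ w s * weightedMaxNorm w y := by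
  have := norm_le_pi_norm (fun s => y s / w s) s
  rw [Real.norm_eq_abs, abs_div, abs_of_pos (hw s), div_le_iff₀ (hw s)] at this
  rw [mul_comm]
  exact this

lemma tendsto_weightedMaxNorm_zero (w : n → ℝ) {e : ℕ → n → ℝ} (he : Tendsto e atTop (𝓝 0)) :
    Tendsto (fun t => weightedMaxNorm w (e t)) atTop (𝓝 0) := by
  have : Tendsto (fun t s => e t s / w s) atTop (𝓝 (0 : n → ℝ)) := by
    rw [tendsto_pi_nhds] at he ⊢
    intro s
    simpa using (he s).div_const (w s)
  have := this.norm
  rwa [norm_zero] at this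

/-- A nonnegative matrix `B` with row sums at most one such that `1 - B` is invertible is a
contraction for a weighted maximum norm, whose weight solves `w = 1 + B w`. -/
lemma exists_weightedMaxNorm_mulVec_le [DecidableEq n] [Nonempty n] {B : Matrix n n ℝ}
    (hB : ∀ i j, 0 ≤ B i j) (hrow : ∀ i, ∑ j, B i j ≤ 1) (hunit : IsUnit (1 - B)) :
    ∃ w : n → ℝ, (∀ s, 0 < w s) ∧ ∃ κ : ℝ, 0 ≤ κ ∧ κ < 1 ∧ ∀ y : n → ℝ,
      weightedMaxNorm w (Matrix.mulVec B y) ≤ κ * weightedMaxNorm w y := by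
  obtain ⟨w, hw⟩ := (Matrix.mulVec_surjective_iff_isUnit.2 hunit) 1
  have hw' : ∀ i, w i = 1 + ∑ j, B i j * w j := fun i => by
    have := congrFun hw i
    rw [Matrix.sub_mulVec, Matrix.one_mulVec] at this
    exact sub_eq_iff_eq_add.1 this
  obtain ⟨i₀, hi₀⟩ := Finite.exists_min w
  have hmin : 0 ≤ w i₀ := by
    by_contra! hneg
    have h1 : (∑ j, B i₀ j) * w i₀ ≤ ∑ j, B i₀ j * w j := by
      rw [Finset.sum_mul]
      exact Finset.sum_le_sum fun j _ => mul_le_mul_of_nonneg_left (hi₀ j) (hB i₀ j)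
    nlinarith [hw' i₀, hrow i₀]
  have hwnonneg : ∀ i, 0 ≤ w i := fun i => hmin.trans (hi₀ i)
  have hw1 : ∀ i, 1 ≤ w i := fun i => by
    rw [hw' i]
    exact le_add_of_nonneg_right (Finset.sum_nonneg fun j _ => mul_nonneg (hB i j) (hwnonneg j))
  have hwpos : ∀ i, 0 < w i := fun i => one_pos.trans_le (hw1 i)
  obtain ⟨i₁, hi₁⟩ := Finite.exists_max w
  have hκ0 : 0 ≤ 1 - 1 / w i₁ := by
    rw [sub_nonneg, div_le_one (hwpos i₁)]
    exact hw1 i₁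
  refine ⟨w, hwpos, 1 - 1 / w i₁, hκ0, sub_lt_self _ (by have := hwpos i₁; positivity),
    fun y => ?_⟩
  refine (pi_norm_le_iff_of_nonneg (mul_nonneg hκ0 (weightedMaxNorm_nonneg w y))).2 fun i => ?_
  rw [Real.norm_eq_abs, abs_div, abs_of_pos (hwpos i), div_le_iff₀ (hwpos i)]
  have hBw : ∑ j, B i j * w j ≤ (1 - 1 / w i₁) * w i := by
    have : 1 / w i₁ * w i ≤ 1 := by
      rw [one_div_mul_eq_div, div_le_one (hwpos i₁)]
      exact hi₁ i
    linarith [hw' i]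
  calc |Matrix.mulVec B y i| ≤ ∑ j, B i j * |y j| := by
        refine (Finset.abs_sum_le_sum_abs _ _).trans (Finset.sum_le_sum fun j _ => ?_)
        rw [abs_mul, abs_of_nonneg (hB i j)]
    _ ≤ ∑ j, B i j * (w j * weightedMaxNorm w y) := Finset.sum_le_sum fun j _ =>
        mul_le_mul_of_nonneg_left (abs_le_mul_weightedMaxNorm hwpos y j) (hB i j)
    _ = (∑ j, B i j * w j) * weightedMaxNorm w y := by
        rw [Finset.sum_mul]
        exact Finset.sum_congr rfl fun j _ => (mul_assoc _ _ _).symm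
    _ ≤ ((1 - 1 / w i₁) * w i) * weightedMaxNorm w y :=
        mul_le_mul_of_nonneg_right hBw (weightedMaxNorm_nonneg w y)
    _ = (1 - 1 / w i₁) * weightedMaxNorm w y * w i := by ring

end WeightedMaxNorm

/-- A nonnegative sequence with `a (t + 1) ≤ κ a t + e t`, `κ < 1` and `e → 0` tends to `0`. -/
lemma tendsto_zero_of_le_mul_add {a e : ℕ → ℝ} {κ : ℝ} (hκ0 : 0 ≤ κ) (hκ1 : κ < 1)
    (ha : ∀ t, 0 ≤ a t) (hae : ∀ t, a (t + 1) ≤ κ * a t + e t) (he : Tendsto e atTop (𝓝 0)) :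
    Tendsto a atTop (𝓝 0) := by
  refine (tendsto_order.2 ⟨fun b hb => Eventually.of_forall fun t => hb.trans_le (ha t),
    fun b hb => ?_⟩)
  have hb2 : 0 < (1 - κ) * (b / 2) := mul_pos (sub_pos.2 hκ1) (half_pos hb)
  obtain ⟨T, hT⟩ := eventually_atTop.1 (he.eventually_le_const hb2)
  have hgeom : ∀ k, a (k + T) ≤ κ ^ k * a T + b / 2 := by
    intro k
    induction k with
    | zero => simpa using (half_pos hb).le
    | succ k ih =>
      have h1 := hae (k + T)
      have h2 := hT (k + T) (Nat.le_add_left T k)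
      have h3 := mul_le_mul_of_nonneg_left ih hκ0
      rw [Nat.add_right_comm, pow_succ']
      linarith
  have hlim : Tendsto (fun k => κ ^ k * a T + b / 2) atTop (𝓝 (b / 2)) := by
    simpa using ((tendsto_pow_atTop_nhds_zero_of_lt_one hκ0 hκ1).mul_const (a T)).add_const (b / 2)
  have hev := hlim.eventually_lt_const (half_lt_self hb)
  filter_upwards [(tendsto_sub_atTop_nat T).eventually hev, eventually_ge_atTop T] with t ht hTt
  have := hgeom (t - T)
  rw [Nat.sub_add_cancel hTt] at this
  linarith

section Trajectory

variable {Ω 𝒮 𝒜 : Type*} [MeasurableSpace 𝒮] [MeasurableSpace 𝒜]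

lemma integral_mul_eq_of_condExp_ae_eq {m mΩ : MeasurableSpace Ω} {μ : Measure Ω}
    [IsFiniteMeasure μ] (hm : m ≤ mΩ) {f g h : Ω → ℝ} (hf : StronglyMeasurable[m] f)
    (hg : Integrable g μ) (hfg : Integrable (fun ω => f ω * g ω) μ) (hgh : μ[g | m] =ᵐ[μ] h) :
    ∫ ω, f ω * g ω ∂μ = ∫ ω, f ω * h ω ∂μ := by
  rw [← integral_condExp hm]
  refine integral_congr_ae ?_
  filter_upwards [condExp_mul_of_stronglyMeasurable_left hf hfg hg, hgh] with ω h1 h2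
  exact h1.trans (congrArg (f ω * ·) h2)

lemma ProbabilityTheory.integral_cond_eq_div {mΩ : MeasurableSpace Ω} (μ : Measure Ω) (s : Set Ω)
    (f : Ω → ℝ) : ∫ ω, f ω ∂(ProbabilityTheory.cond μ s) = (∫ ω in s, f ω ∂μ) / μ.real s := by
  rw [ProbabilityTheory.cond, integral_smul_measure, ENNReal.toReal_inv, smul_eq_mul,
    div_eq_inv_mul]
  rfl

section History

variable (S : ℕ → Ω → 𝒮) (A : ℕ → Ω → 𝒜) (R : ℕ → Ω → ℝ)

lemma measurable_state_history {i t : ℕ} (h : i ≤ t) : Measurable[history S A R t] (S i) := by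
  rw [measurable_iff_comap_le]
  exact le_sup_of_le_left (le_sup_of_le_left
    (le_iSup₂_of_le (f := fun i (_ : i ∈ Set.Iic t) => MeasurableSpace.comap (S i) inferInstance)
      i h le_rfl))

lemma measurable_action_history {i t : ℕ} (h : i < t) : Measurable[history S A R t] (A i) := by
  rw [measurable_iff_comap_le]
  exact le_sup_of_le_left (le_sup_of_le_right
    (le_iSup₂_of_le (f := fun i (_ : i ∈ Set.Iio t) => MeasurableSpace.comap (A i) inferInstance)
      i h le_rfl))

lemma measurable_reward_history {i t : ℕ} (h : i < t) :
    Measurable[history S A R t] (R (i + 1)) := by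
  rw [measurable_iff_comap_le]
  exact le_sup_of_le_right
    (le_iSup₂_of_le
      (f := fun i (_ : i ∈ Set.Iio t) => MeasurableSpace.comap (R (i + 1)) inferInstance)
      i h le_rfl)

lemma history_mono {t u : ℕ} (h : t ≤ u) : history S A R t ≤ history S A R u :=
  sup_le (sup_le
    (iSup₂_le fun _ hi => (measurable_state_history S A R (le_trans hi h)).comap_le)
    (iSup₂_le fun _ hi => (measurable_action_history S A R (lt_of_lt_of_le hi h)).comap_le))
    (iSup₂_le fun _ hi => (measurable_reward_history S A R (lt_of_lt_of_le hi h)).comap_le)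

lemma measurable_reverseReturn_history [DiscreteMeasurableSpace 𝒮] (γ : 𝒮 → ℝ) (t : ℕ) :
    Measurable[history S A R t] (reverseReturn γ S R t) := by
  induction t with
  | zero => exact measurable_const
  | succ t ih =>
    have hS : Measurable[history S A R (t + 1)] fun ω => γ (S t ω) :=
      (Measurable.of_discrete (f := γ)).comp (measurable_state_history S A R t.le_succ)
    exact (measurable_reward_history S A R t.lt_succ_self).add
      (hS.mul (ih.mono (history_mono S A R t.le_succ) le_rfl))

end History

namespace IsTrajectory

variable [Fintype 𝒮] [Fintype 𝒜] [DiscreteMeasurableSpace 𝒮] [DiscreteMeasurableSpace 𝒜]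
  [mΩ : MeasurableSpace Ω] {M : FiniteMDP 𝒮 𝒜} {π : Policy 𝒮 𝒜} {r : 𝒮 × 𝒜 → ℝ}
  {μ : Measure Ω} {S : ℕ → Ω → 𝒮} {A : ℕ → Ω → 𝒜} {R : ℕ → Ω → ℝ}

lemma history_le (h : IsTrajectory M π r μ S A R) (t : ℕ) : history S A R t ≤ mΩ :=
  sup_le (sup_le
    (iSup₂_le fun i _ => (h.measurable_state i).comap_le)
    (iSup₂_le fun i _ => (h.measurable_action i).comap_le))
    (iSup₂_le fun i _ => (h.measurable_reward i).comap_le)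

lemma history_sup_action_le (h : IsTrajectory M π r μ S A R) (t : ℕ) :
    history S A R t ⊔ MeasurableSpace.comap (A t) inferInstance ≤ mΩ :=
  sup_le (h.history_le t) (h.measurable_action t).comap_le

lemma measurable_pair (h : IsTrajectory M π r μ S A R) (t : ℕ) :
    Measurable fun ω => (S t ω, A t ω) :=
  (h.measurable_state t).prodMk (h.measurable_action t)

lemma measurable_pair_history (t : ℕ) :
    Measurable[history S A R t ⊔ MeasurableSpace.comap (A t) inferInstance]
      fun ω => (S t ω, A t ω) :=
  ((measurable_state_history S A R le_rfl).mono le_sup_left le_rfl).prodMk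
    (measurable_iff_comap_le.2 le_sup_right)

lemma integrable_mul_pair (h : IsTrajectory M π r μ S A R) (t : ℕ) {f : Ω → ℝ}
    (hf : Integrable f μ) (q : 𝒮 × 𝒜 → ℝ) : Integrable (fun ω => f ω * q (S t ω, A t ω)) μ := by
  obtain ⟨C, hC⟩ := (Set.finite_range fun x => ‖q x‖).bddAbove
  exact hf.mul_bdd (c := C)
    ((Measurable.of_discrete (f := q)).comp (h.measurable_pair t)).aestronglyMeasurable
    (Eventually.of_forall fun ω => hC ⟨_, rfl⟩)

lemma integrable_mul_state (h : IsTrajectory M π r μ S A R) (t : ℕ) {f : Ω → ℝ}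
    (hf : Integrable f μ) (q : 𝒮 → ℝ) : Integrable (fun ω => f ω * q (S t ω)) μ :=
  h.integrable_mul_pair t hf fun x => q x.1

lemma integrable_indicator_state [IsFiniteMeasure μ] (h : IsTrajectory M π r μ S A R) (t : ℕ)
    (s : 𝒮) : Integrable ((S t ⁻¹' {s}).indicator fun _ => (1 : ℝ)) μ :=
  (integrable_const 1).indicator (h.measurable_state t (measurableSet_singleton s))

lemma integrable_indicator_action [IsFiniteMeasure μ] (h : IsTrajectory M π r μ S A R) (t : ℕ)
    (a : 𝒜) : Integrable ((A t ⁻¹' {a}).indicator fun _ => (1 : ℝ)) μ :=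
  (integrable_const 1).indicator (h.measurable_action t (measurableSet_singleton a))

lemma setIntegral_state (h : IsTrajectory M π r μ S A R) (t : ℕ) (s : 𝒮) (f : Ω → ℝ) :
    ∫ ω in S t ⁻¹' {s}, f ω ∂μ = ∫ ω, f ω * (S t ⁻¹' {s}).indicator (fun _ => (1 : ℝ)) ω ∂μ := by
  rw [← integral_indicator (h.measurable_state t (measurableSet_singleton s))]
  refine integral_congr_ae (Eventually.of_forall fun ω => ?_)
  by_cases hω : ω ∈ S t ⁻¹' {s} <;> simp [hω]

lemma integrable_mul_indicator_state (h : IsTrajectory M π r μ S A R) (t : ℕ) (s : 𝒮) {f : Ω → ℝ}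
    (hf : Integrable f μ) :
    Integrable (fun ω => f ω * (S t ⁻¹' {s}).indicator (fun _ => (1 : ℝ)) ω) μ := by
  classical
  convert h.integrable_mul_state t hf (Pi.single s 1) using 3 with ω
  by_cases hω : S t ω = s <;> simp [hω]

lemma integral_mul_state_eq_sum (h : IsTrajectory M π r μ S A R) (t : ℕ) {f : Ω → ℝ}
    (hf : Integrable f μ) (q : 𝒮 → ℝ) :
    ∫ ω, f ω * q (S t ω) ∂μ = ∑ s, q s * ∫ ω in S t ⁻¹' {s}, f ω ∂μ := by
  classical
  simp_rw [h.setIntegral_state t, ← integral_const_mul]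
  rw [← integral_finsetSum _ fun s _ => (h.integrable_mul_indicator_state t s hf).const_mul _]
  refine integral_congr_ae (Eventually.of_forall fun ω => ?_)
  simp [Set.indicator_apply, mul_comm, eq_comm]

/-- Averaging over the action: `E[f q(S_t, A_t)] = ∑ₛ (∑ₐ π(a | s) q(s, a)) E[f; S_t = s]` for `f`
determined by the past. -/
lemma integral_mul_pair [IsFiniteMeasure μ] (h : IsTrajectory M π r μ S A R) (t : ℕ) {f : Ω → ℝ}
    (hfm : StronglyMeasurable[history S A R t] f) (hf : Integrable f μ) (q : 𝒮 × 𝒜 → ℝ) :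
    ∫ ω, f ω * q (S t ω, A t ω) ∂μ =
      ∑ s, (∑ a, π.prob s a * q (s, a)) * ∫ ω in S t ⁻¹' {s}, f ω ∂μ := by
  classical
  have hint : ∀ a, Integrable
      (fun ω => f ω * q (S t ω, a) * (A t ⁻¹' {a}).indicator (fun _ => (1 : ℝ)) ω) μ := fun a => by
    convert h.integrable_mul_pair t (h.integrable_mul_state t hf fun s => q (s, a))
      (fun x => (Pi.single a 1 : 𝒜 → ℝ) x.2) using 3 with ω
    by_cases hω : A t ω = a <;> simp [hω]
  have hact : ∀ a, ∫ ω, f ω * q (S t ω, a) * (A t ⁻¹' {a}).indicator (fun _ => (1 : ℝ)) ω ∂μ =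
      ∫ ω, f ω * q (S t ω, a) * π.prob (S t ω) a ∂μ := fun a => by
    refine integral_mul_eq_of_condExp_ae_eq (h.history_le t)
      (hfm.mul ((Measurable.of_discrete (f := fun s => q (s, a))).comp
        (measurable_state_history S A R le_rfl)).stronglyMeasurable)
      (h.integrable_indicator_action t a) (hint a) (h.action_law t a)
  calc ∫ ω, f ω * q (S t ω, A t ω) ∂μ
      = ∫ ω, ∑ a, f ω * q (S t ω, a) * (A t ⁻¹' {a}).indicator (fun _ => (1 : ℝ)) ω ∂μ := by
        refine integral_congr_ae (Eventually.of_forall fun ω => ?_)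
        simp [Set.indicator_apply, eq_comm]
    _ = ∑ a, ∫ ω, f ω * q (S t ω, a) * π.prob (S t ω) a ∂μ := by
        rw [integral_finsetSum _ fun a _ => hint a]
        exact Finset.sum_congr rfl fun a _ => hact a
    _ = ∫ ω, f ω * ∑ a, π.prob (S t ω) a * q (S t ω, a) ∂μ := by
        rw [← integral_finsetSum _ fun a _ =>
          h.integrable_mul_state t (h.integrable_mul_state t hf fun s => q (s, a))
            fun s => π.prob s a]
        refine integral_congr_ae (Eventually.of_forall fun ω => ?_)
        simp only [Finset.mul_sum]
        exact Finset.sum_congr rfl fun a _ => by ring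
    _ = _ := h.integral_mul_state_eq_sum t hf fun s => ∑ a, π.prob s a * q (s, a)

lemma integral_mul_pair_mul_indicator [IsFiniteMeasure μ] (h : IsTrajectory M π r μ S A R) (t : ℕ)
    {f : Ω → ℝ} (hfm : StronglyMeasurable[history S A R t] f) (hf : Integrable f μ)
    (q : 𝒮 × 𝒜 → ℝ) (s' : 𝒮) :
    ∫ ω in S (t + 1) ⁻¹' {s'}, f ω * q (S t ω, A t ω) ∂μ =
      ∑ s, (∑ a, π.prob s a * (q (s, a) * M.p s a s')) * ∫ ω in S t ⁻¹' {s}, f ω ∂μ := by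
  rw [h.setIntegral_state, ← h.integral_mul_pair t hfm hf fun x => q x * M.p x.1 x.2 s',
    integral_mul_eq_of_condExp_ae_eq (h.history_sup_action_le t) ?_
      (h.integrable_indicator_state (t + 1) s')
      (h.integrable_mul_indicator_state (t + 1) s' (h.integrable_mul_pair t hf q))
      (h.state_law t s')]
  · exact integral_congr_ae (Eventually.of_forall fun ω => by ring)
  · have hq := ((Measurable.of_discrete (f := q)).comp
      (measurable_pair_history (S := S) (A := A) (R := R) t)).stronglyMeasurable
    have hf' : StronglyMeasurable[history S A R t ⊔
      MeasurableSpace.comap (A t) inferInstance] f := hfm.mono le_sup_left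
    exact hf'.mul hq

/-- The Markov property: `E[f; S_{t+1} = s'] = ∑ₛ P_π(s, s') E[f; S_t = s]` for `f` determined by
the past. -/
lemma setIntegral_state_succ [IsFiniteMeasure μ] (h : IsTrajectory M π r μ S A R) (t : ℕ)
    {f : Ω → ℝ} (hfm : StronglyMeasurable[history S A R t] f) (hf : Integrable f μ) (s' : 𝒮) :
    ∫ ω in S (t + 1) ⁻¹' {s'}, f ω ∂μ =
      ∑ s, M.stateTransition π s s' * ∫ ω in S t ⁻¹' {s}, f ω ∂μ := by
  simpa [FiniteMDP.stateTransition] using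
    h.integral_mul_pair_mul_indicator t hfm hf (fun _ => 1) s'

lemma measureReal_state_succ [IsFiniteMeasure μ] (h : IsTrajectory M π r μ S A R) (t : ℕ)
    (s' : 𝒮) : μ.real (S (t + 1) ⁻¹' {s'}) =
      ∑ s, M.stateTransition π s s' * μ.real (S t ⁻¹' {s}) := by
  simpa using h.setIntegral_state_succ t (f := fun _ => 1) stronglyMeasurable_const
    (integrable_const 1) s'

lemma measureReal_state_eq_vecMul [DecidableEq 𝒮] [IsFiniteMeasure μ]
    (h : IsTrajectory M π r μ S A R) (t : ℕ) : (fun s => μ.real (S t ⁻¹' {s})) =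
      Matrix.vecMul M.μ₀ (M.stateTransition π ^ t) := by
  induction t with
  | zero => simpa using funext h.initial_state
  | succ t ih =>
    rw [Matrix.vecMul_pow_succ, ← ih]
    ext s'
    rw [h.measureReal_state_succ]
    exact Finset.sum_congr rfl fun s _ => mul_comm _ _

lemma integrable_reward [IsFiniteMeasure μ] (h : IsTrajectory M π r μ S A R) (t : ℕ) :
    Integrable (R (t + 1)) μ := by
  obtain ⟨C, hC⟩ := h.bounded_reward
  exact Integrable.of_bound (h.measurable_reward t).aestronglyMeasurable C (hC t)

lemma setIntegral_reward [IsFiniteMeasure μ] (h : IsTrajectory M π r μ S A R) (t : ℕ) (s' : 𝒮) :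
    ∫ ω in S (t + 1) ⁻¹' {s'}, R (t + 1) ω ∂μ =
      ∑ s, (∑ a, π.prob s a * (r (s, a) * M.p s a s')) * μ.real (S t ⁻¹' {s}) := by
  have hm : history S A R t ⊔ MeasurableSpace.comap (A t) inferInstance ⊔
      MeasurableSpace.comap (S (t + 1)) inferInstance ≤ mΩ :=
    sup_le (h.history_sup_action_le t) (h.measurable_state (t + 1)).comap_le
  have hmeas : MeasurableSet[history S A R t ⊔ MeasurableSpace.comap (A t) inferInstance ⊔
      MeasurableSpace.comap (S (t + 1)) inferInstance] (S (t + 1) ⁻¹' {s'}) :=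
    (le_sup_right : MeasurableSpace.comap (S (t + 1)) inferInstance ≤ _) _
      ⟨{s'}, measurableSet_singleton s', rfl⟩
  rw [← setIntegral_condExp hm (h.integrable_reward t) hmeas,
    setIntegral_congr_ae (hm _ hmeas) ((h.reward_mean t).mono fun ω hω _ => hω)]
  simpa using h.integral_mul_pair_mul_indicator t (f := fun _ => 1) stronglyMeasurable_const
    (integrable_const 1) r s'

lemma integrable_reverseReturn [IsFiniteMeasure μ] (h : IsTrajectory M π r μ S A R) (γ : 𝒮 → ℝ)
    (t : ℕ) : Integrable (reverseReturn γ S R t) μ := by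
  induction t with
  | zero => exact integrable_zero _ _ _
  | succ t ih =>
    refine (h.integrable_reward t).add ?_
    simpa only [mul_comm] using h.integrable_mul_state t ih γ

/-- The recursion for `E[Ḡ_t; S_t = s]`. -/
lemma setIntegral_reverseReturn_succ [IsFiniteMeasure μ] (h : IsTrajectory M π r μ S A R)
    (γ : 𝒮 → ℝ) (t : ℕ) (s' : 𝒮) :
    ∫ ω in S (t + 1) ⁻¹' {s'}, reverseReturn γ S R (t + 1) ω ∂μ =
      ∑ s, (∑ a, π.prob s a * (r (s, a) * M.p s a s')) * μ.real (S t ⁻¹' {s}) +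
      ∑ s, M.stateTransition π s s' * (γ s * ∫ ω in S t ⁻¹' {s}, reverseReturn γ S R t ω ∂μ) := by
  have hint : Integrable (fun ω => γ (S t ω) * reverseReturn γ S R t ω) μ := by
    simpa only [mul_comm] using h.integrable_mul_state t (h.integrable_reverseReturn γ t) γ
  have hmeas : StronglyMeasurable[history S A R t] fun ω =>
      γ (S t ω) * reverseReturn γ S R t ω :=
    (((Measurable.of_discrete (f := γ)).comp (measurable_state_history S A R le_rfl)).mul
      (measurable_reverseReturn_history S A R γ t)).stronglyMeasurable
  simp only [reverseReturn]
  rw [integral_add (h.integrable_reward t).integrableOn hint.integrableOn, h.setIntegral_reward,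
    h.setIntegral_state_succ t hmeas hint]
  congr 1
  refine Finset.sum_congr rfl fun s _ => ?_
  have hγs : ∫ ω in S t ⁻¹' {s}, γ (S t ω) * reverseReturn γ S R t ω ∂μ =
      ∫ ω in S t ⁻¹' {s}, γ s * reverseReturn γ S R t ω ∂μ :=
    setIntegral_congr_fun (h.measurable_state t (measurableSet_singleton s))
      fun ω (hω : S t ω = s) => by simp only [hω]
  rw [hγs, integral_const_mul]

end IsTrajectory

end Trajectory

namespace FiniteMDP

variable {𝒮 𝒜 : Type*} [Fintype 𝒮] [Fintype 𝒜] [DecidableEq 𝒮] [DecidableEq 𝒜]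

lemma stateTransition_mem_rowStochastic (M : FiniteMDP 𝒮 𝒜) (π : Policy 𝒮 𝒜) :
    M.stateTransition π ∈ Matrix.rowStochastic ℝ 𝒮 := by
  refine Matrix.mem_rowStochastic_iff_sum.2 ⟨fun i j => Finset.sum_nonneg fun a _ =>
    mul_nonneg ((π.prob_mem i).1 a) ((M.p_mem i a).1 j), fun i => ?_⟩
  simp only [stateTransition, Matrix.of_apply]
  rw [Finset.sum_comm]
  simp [← Finset.mul_sum, (M.p_mem i _).2, (π.prob_mem i).2]

/-- The expected reward collected upon entering `s'` when the previous state has weights `m`. -/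
def rewardFlow (M : FiniteMDP 𝒮 𝒜) (π : Policy 𝒮 𝒜) (r : 𝒮 × 𝒜 → ℝ) (m : 𝒮 → ℝ) (s' : 𝒮) : ℝ :=
  ∑ s, (∑ a, π.prob s a * (r (s, a) * M.p s a s')) * m s

lemma pairTransition_transpose_mul_pairWeight_mulVec (M : FiniteMDP 𝒮 𝒜) (π : Policy 𝒮 𝒜)
    (r : 𝒮 × 𝒜 → ℝ) (m : 𝒮 → ℝ) :
    Matrix.mulVec (M.pairTransition.transpose * pairWeight π m) r = M.rewardFlow π r m := by
  ext s'
  simp only [rewardFlow, pairTransition, pairWeight, Matrix.mulVec, dotProduct,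
    Matrix.mul_diagonal, Matrix.transpose_apply, Matrix.of_apply, Fintype.sum_prod_type,
    Finset.sum_mul]
  exact Finset.sum_congr rfl fun s _ => Finset.sum_congr rfl fun a _ => by ring

lemma tendsto_rewardFlow (M : FiniteMDP 𝒮 𝒜) (π : Policy 𝒮 𝒜) (r : 𝒮 × 𝒜 → ℝ)
    {m : ℕ → 𝒮 → ℝ} {d : 𝒮 → ℝ} (hm : Tendsto m atTop (𝓝 d)) :
    Tendsto (fun t => M.rewardFlow π r (m t)) atTop (𝓝 (M.rewardFlow π r d)) := by
  rw [tendsto_pi_nhds] at hm ⊢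
  exact fun s' => tendsto_finsetSum _ fun s _ => (hm s).const_mul _

end FiniteMDP

lemma Matrix.isUnit_det_diagonal_of_pos {n : Type*} [Fintype n] [DecidableEq n] {d : n → ℝ}
    (hd : ∀ s, 0 < d s) : IsUnit (Matrix.diagonal d).det := by
  rw [Matrix.det_diagonal]
  exact (Finset.prod_pos fun s _ => hd s).ne'.isUnit

lemma Matrix.inv_diagonal_of_pos {n : Type*} [Fintype n] [DecidableEq n] {d : n → ℝ}
    (hd : ∀ s, 0 < d s) : (Matrix.diagonal d)⁻¹ = Matrix.diagonal fun s => (d s)⁻¹ := by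
  refine Matrix.inv_eq_left_inv ?_
  rw [Matrix.diagonal_mul_diagonal, ← Matrix.diagonal_one]
  exact congrArg _ (funext fun s => inv_mul_cancel₀ (hd s).ne')

namespace FiniteMDP

variable {𝒮 𝒜 : Type*} [Fintype 𝒮] [Fintype 𝒜] [DecidableEq 𝒮] [DecidableEq 𝒜]

/-- The linear part `D⁻¹ Pᵀ Γ D` of the reverse Bellman operator. -/
noncomputable def discountedReversal (M : FiniteMDP 𝒮 𝒜) (π : Policy 𝒮 𝒜) (γ d : 𝒮 → ℝ) :
    Matrix 𝒮 𝒮 ℝ :=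
  (Matrix.diagonal d)⁻¹ * (M.stateTransition π).transpose * Matrix.diagonal γ * Matrix.diagonal d

variable (M : FiniteMDP 𝒮 𝒜) (π : Policy 𝒮 𝒜) (r : 𝒮 × 𝒜 → ℝ) (γ : 𝒮 → ℝ) {d : 𝒮 → ℝ}

lemma discountedReversal_apply (hd : ∀ s, 0 < d s) (i j : 𝒮) :
    M.discountedReversal π γ d i j = (d i)⁻¹ * M.stateTransition π j i * γ j * d j := by
  rw [discountedReversal, Matrix.inv_diagonal_of_pos hd, Matrix.mul_diagonal, Matrix.mul_diagonal,
    Matrix.diagonal_mul, Matrix.transpose_apply]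

lemma reverseBellman_eq (d y : 𝒮 → ℝ) : M.reverseBellman π r γ d y =
    Matrix.mulVec (Matrix.diagonal d)⁻¹ (M.rewardFlow π r d) +
      Matrix.mulVec (M.discountedReversal π γ d) y := by
  rw [reverseBellman, Matrix.mul_assoc _ M.pairTransition.transpose, ← Matrix.mulVec_mulVec,
    pairTransition_transpose_mul_pairWeight_mulVec]
  rfl

lemma reverseBellman_sub (d y z : 𝒮 → ℝ) :
    M.reverseBellman π r γ d y - M.reverseBellman π r γ d z =
      Matrix.mulVec (M.discountedReversal π γ d) (y - z) := by
  rw [reverseBellman_eq, reverseBellman_eq, add_sub_add_left_eq_sub, Matrix.mulVec_sub]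

lemma reverseBellman_apply (hd : ∀ s, 0 < d s) (y : 𝒮 → ℝ) (s' : 𝒮) :
    M.reverseBellman π r γ d y s' = (M.rewardFlow π r d s' +
      ∑ s, M.stateTransition π s s' * (γ s * (d s * y s))) / d s' := by
  rw [reverseBellman_eq, Matrix.inv_diagonal_of_pos hd, Pi.add_apply, Matrix.mulVec_diagonal,
    add_div, Finset.sum_div]
  congr 1
  · rw [div_eq_inv_mul]
  · refine Finset.sum_congr rfl fun s _ => ?_
    change M.discountedReversal π γ d s' s * y s = _
    rw [discountedReversal_apply M π γ hd, div_eq_inv_mul]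
    ring

lemma exists_weightedMaxNorm_reverseBellman_sub_le (hγ : ∀ s, γ s ∈ Set.Icc (0 : ℝ) 1)
    [Nonempty 𝒮] (hd : ∀ s, 0 < d s) (hst : IsStationaryDistribution (M.stateTransition π) d)
    (hinv : IsUnit (1 - (M.stateTransition π).transpose * Matrix.diagonal γ)) :
    ∃ w : 𝒮 → ℝ, (∀ s, 0 < w s) ∧ ∃ κ : ℝ, 0 ≤ κ ∧ κ < 1 ∧ ∀ y z : 𝒮 → ℝ,
      weightedMaxNorm w (M.reverseBellman π r γ d y - M.reverseBellman π r γ d z)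
        ≤ κ * weightedMaxNorm w (y - z) := by
  have hP := M.stateTransition_mem_rowStochastic π
  have hB : ∀ i j, 0 ≤ M.discountedReversal π γ d i j := fun i j => by
    rw [discountedReversal_apply M π γ hd]
    exact mul_nonneg (mul_nonneg (mul_nonneg (inv_nonneg.2 (hd i).le)
      (Matrix.nonneg_of_mem_rowStochastic hP)) (hγ j).1) (hd j).le
  have hrow : ∀ i, ∑ j, M.discountedReversal π γ d i j ≤ 1 := fun i => by
    have hi : ∑ j, d j * M.stateTransition π j i = d i := congrFun hst.2 i
    calc ∑ j, M.discountedReversal π γ d i j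
        ≤ ∑ j, (d i)⁻¹ * (d j * M.stateTransition π j i) := by
          refine Finset.sum_le_sum fun j _ => ?_
          rw [discountedReversal_apply M π γ hd]
          have h1 : 0 ≤ (d i)⁻¹ * (d j * M.stateTransition π j i) :=
            mul_nonneg (inv_nonneg.2 (hd i).le)
              (mul_nonneg (hd j).le (Matrix.nonneg_of_mem_rowStochastic hP))
          calc _ = (d i)⁻¹ * (d j * M.stateTransition π j i) * γ j := by ring
            _ ≤ _ := mul_le_of_le_one_right h1 (hγ j).2
      _ = 1 := by rw [← Finset.mul_sum, hi, inv_mul_cancel₀ (hd i).ne']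
  have hD := Matrix.isUnit_det_diagonal_of_pos hd
  have hunit : IsUnit (1 - M.discountedReversal π γ d) := by
    have : 1 - M.discountedReversal π γ d = (Matrix.diagonal d)⁻¹ *
        (1 - (M.stateTransition π).transpose * Matrix.diagonal γ) * Matrix.diagonal d := by
      rw [Matrix.mul_sub, Matrix.sub_mul, Matrix.mul_one, Matrix.nonsing_inv_mul _ hD,
        discountedReversal]
      simp only [Matrix.mul_assoc]
    rw [this]
    have hDu := (Matrix.isUnit_iff_isUnit_det _).2 hD
    exact ((Matrix.isUnit_nonsing_inv_iff.2 hDu).mul hinv).mul hDu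
  obtain ⟨w, hw, κ, hκ0, hκ1, hκ⟩ := exists_weightedMaxNorm_mulVec_le hB hrow hunit
  exact ⟨w, hw, κ, hκ0, hκ1, fun y z => by rw [reverseBellman_sub]; exact hκ _⟩

/-- The closed form solves the reverse Bellman equation. -/
lemma reverseBellman_closedForm (hd : ∀ s, 0 < d s)
    (hinv : IsUnit (1 - (M.stateTransition π).transpose * Matrix.diagonal γ)) :
    M.reverseBellman π r γ d (Matrix.mulVec ((Matrix.diagonal d)⁻¹ *
      (1 - (M.stateTransition π).transpose * Matrix.diagonal γ)⁻¹ *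
      M.pairTransition.transpose * pairWeight π d) r) =
    Matrix.mulVec ((Matrix.diagonal d)⁻¹ *
      (1 - (M.stateTransition π).transpose * Matrix.diagonal γ)⁻¹ *
      M.pairTransition.transpose * pairWeight π d) r := by
  set X := (M.stateTransition π).transpose * Matrix.diagonal γ with hX
  have hD := Matrix.isUnit_det_diagonal_of_pos hd
  have hdet := (Matrix.isUnit_iff_isUnit_det _).1 hinv
  have hres : 1 + X * (1 - X)⁻¹ = (1 - X)⁻¹ := by
    have := Matrix.mul_nonsing_inv _ hdet
    rw [Matrix.sub_mul, Matrix.one_mul] at this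
    exact (sub_eq_iff_eq_add.1 this).symm
  rw [reverseBellman_eq, Matrix.mul_assoc _ M.pairTransition.transpose,
    ← Matrix.mulVec_mulVec _ _ (M.pairTransition.transpose * _), pairTransition_transpose_mul_pairWeight_mulVec,
    Matrix.mulVec_mulVec, ← Matrix.add_mulVec]
  congr 1
  have : M.discountedReversal π γ d * ((Matrix.diagonal d)⁻¹ * (1 - X)⁻¹) =
      (Matrix.diagonal d)⁻¹ * (X * (1 - X)⁻¹) := by
    rw [discountedReversal, Matrix.mul_assoc _ _ (Matrix.diagonal γ), ← hX,
      Matrix.mul_assoc _ (Matrix.diagonal d), ← Matrix.mul_assoc (Matrix.diagonal d),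
      Matrix.mul_nonsing_inv _ hD, Matrix.one_mul, Matrix.mul_assoc]
  rw [this, ← mul_one_add, hres]

end FiniteMDP

/-- The iteration `y ↦ T y + e` of a weighted maximum norm contraction `T` with vanishing
perturbations `e` converges to the fixed point of `T`. -/
lemma tendsto_of_weightedMaxNorm_contraction {n : Type*} [Fintype n] {w : n → ℝ}
    (hw : ∀ s, 0 < w s) {κ : ℝ} (hκ0 : 0 ≤ κ) (hκ1 : κ < 1) {T : (n → ℝ) → n → ℝ}
    (hT : ∀ y z, weightedMaxNorm w (T y - T z) ≤ κ * weightedMaxNorm w (y - z)) {v : n → ℝ}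
    (hv : T v = v) {y e : ℕ → n → ℝ} (hy : ∀ t, y (t + 1) = T (y t) + e t)
    (he : Tendsto e atTop (𝓝 0)) : Tendsto y atTop (𝓝 v) := by
  have hlim : Tendsto (fun t => weightedMaxNorm w (y t - v)) atTop (𝓝 0) := by
    refine tendsto_zero_of_le_mul_add hκ0 hκ1 (fun t => weightedMaxNorm_nonneg _ _) (fun t => ?_)
      (tendsto_weightedMaxNorm_zero w he)
    have : y (t + 1) - v = (T (y t) - T v) + e t := by rw [hy, hv]; abel
    rw [this]
    exact (weightedMaxNorm_add_le _ _ _).trans (by gcongr; exact hT _ _)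
  rw [tendsto_pi_nhds]
  intro s
  rw [← tendsto_sub_nhds_zero_iff]
  refine squeeze_zero_norm (fun t => abs_le_mul_weightedMaxNorm hw (y t - v) s) ?_
  simpa using hlim.const_mul (w s)

theorem theorem1 {𝒮 𝒜 Ω : Type*} [Fintype 𝒮] [DecidableEq 𝒮] [Fintype 𝒜] [DecidableEq 𝒜]
    [MeasurableSpace 𝒮] [DiscreteMeasurableSpace 𝒮]
    [MeasurableSpace 𝒜] [DiscreteMeasurableSpace 𝒜] [MeasurableSpace Ω]
    (M : FiniteMDP 𝒮 𝒜) (π : Policy 𝒮 𝒜) (r : 𝒮 × 𝒜 → ℝ)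
    (γ : 𝒮 → ℝ) (hγ : ∀ s, γ s ∈ Set.Icc (0 : ℝ) 1)
    (μ : Measure Ω) [IsProbabilityMeasure μ]
    (S : ℕ → Ω → 𝒮) (A : ℕ → Ω → 𝒜) (R : ℕ → Ω → ℝ)
    (hSAR : IsTrajectory M π r μ S A R)
    (hergodic : IsErgodicChain (M.stateTransition π))
    (hinv : IsUnit (1 - (M.stateTransition π).transpose * Matrix.diagonal γ)) :
    -- the stationary distribution exists, is unique and is positive
    ∃ d : 𝒮 → ℝ, IsStationaryDistribution (M.stateTransition π) d ∧
      (∀ d', IsStationaryDistribution (M.stateTransition π) d' → d' = d) ∧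
      (∀ s, 0 < d s) ∧
      -- the conditional expectations are meaningful for all large `t`, and they converge
      (∀ t, Integrable (reverseReturn γ S R t) μ) ∧
      (∀ s, ∀ᶠ t in atTop, 0 < μ.real (S t ⁻¹' {s})) ∧
      ∃ v : 𝒮 → ℝ,
        (∀ s, Tendsto
          (fun t => ∫ ω, reverseReturn γ S R t ω ∂(ProbabilityTheory.cond μ (S t ⁻¹' {s})))
          atTop (𝓝 (v s))) ∧
        -- the reverse Bellman operator is a contraction in some weighted maximum norm
        (∃ w : 𝒮 → ℝ, (∀ s, 0 < w s) ∧ ∃ κ : ℝ, 0 ≤ κ ∧ κ < 1 ∧ ∀ y z : 𝒮 → ℝ,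
          weightedMaxNorm w (M.reverseBellman π r γ d y - M.reverseBellman π r γ d z)
            ≤ κ * weightedMaxNorm w (y - z)) ∧
        -- `v` is its unique fixed point
        M.reverseBellman π r γ d v = v ∧
        (∀ y, M.reverseBellman π r γ d y = y → y = v) ∧
        -- the closed form of `v`
        v = Matrix.mulVec ((Matrix.diagonal d)⁻¹ *
          (1 - (M.stateTransition π).transpose * Matrix.diagonal γ)⁻¹ *
          M.pairTransition.transpose * FiniteMDP.pairWeight π d) r := by
  have hne : Nonempty 𝒮 := by
    by_contra h
    rw [not_nonempty_iff] at h
    simpa using M.μ₀_mem.2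
  have hP := M.stateTransition_mem_rowStochastic π
  obtain ⟨d, hd⟩ := Matrix.exists_isStationaryDistribution hP
  have hpos := hd.pos hergodic
  have hm : Tendsto (fun t s => μ.real (S t ⁻¹' {s})) atTop (𝓝 d) := by
    exact (hergodic.tendsto_vecMul_pow_stationary hP hd M.μ₀_mem.2).congr fun t =>
      (hSAR.measureReal_state_eq_vecMul t).symm
  have hms := tendsto_pi_nhds.1 hm
  have hcontr := M.exists_weightedMaxNorm_reverseBellman_sub_le π r γ hγ hpos hd hinv
  have hfix := M.reverseBellman_closedForm π r γ hpos hinv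
  obtain ⟨w, hw, κ, hκ0, hκ1, hκ⟩ := hcontr
  refine ⟨d, hd, fun d' hd' => hd.unique hergodic hP hd', hpos,
    hSAR.integrable_reverseReturn γ, fun s => (hms s).eventually_const_lt (hpos s), _,
    fun s => ?_, ⟨w, hw, κ, hκ0, hκ1, hκ⟩, hfix, fun y hy => ?_, rfl⟩
  · have hy : ∀ t, (fun s => (∫ ω in S (t + 1) ⁻¹' {s}, reverseReturn γ S R (t + 1) ω ∂μ) / d s) =
        M.reverseBellman π r γ d
          (fun s => (∫ ω in S t ⁻¹' {s}, reverseReturn γ S R t ω ∂μ) / d s) +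
        fun s => (M.rewardFlow π r (fun s => μ.real (S t ⁻¹' {s})) s -
          M.rewardFlow π r d s) / d s := by
      intro t
      ext s'
      rw [hSAR.setIntegral_reverseReturn_succ, Pi.add_apply, M.reverseBellman_apply π r γ hpos]
      simp_rw [mul_div_cancel₀ _ (hpos _).ne', FiniteMDP.rewardFlow]
      ring
    have he : Tendsto (fun t s => (M.rewardFlow π r (fun s => μ.real (S t ⁻¹' {s})) s -
        M.rewardFlow π r d s) / d s) atTop (𝓝 0) := by
      have h1 := tendsto_pi_nhds.1 (M.tendsto_rewardFlow π r hm)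
      rw [tendsto_pi_nhds]
      intro s
      simpa using ((h1 s).sub_const (M.rewardFlow π r d s)).div_const (d s)
    have hlim := tendsto_pi_nhds.1
      (tendsto_of_weightedMaxNorm_contraction hw hκ0 hκ1 hκ hfix (y := fun t s =>
        (∫ ω in S t ⁻¹' {s}, reverseReturn γ S R t ω ∂μ) / d s) hy he) s
    simp_rw [ProbabilityTheory.integral_cond_eq_div]
    have hratio := (hlim.mul_const (d s)).div (hms s) (hpos s).ne'
    simp_rw [div_mul_cancel₀ _ (hpos s).ne', mul_div_cancel_right₀ _ (hpos s).ne'] at hratio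
    exact hratio
  · have hconst := tendsto_of_weightedMaxNorm_contraction hw hκ0 hκ1 hκ hfix
      (y := fun _ => y) (e := fun _ => 0) (fun _ => by simp [hy]) tendsto_const_nhds
    exact tendsto_nhds_unique tendsto_const_nhds hconst
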